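/- A hypergraph is a family of sets (its edges); its vertex set is the union of its edges. It is countable if its vertex set is finite or countably infinite. The cover number $\tau(\mathcal H)$ is the least size of a set of vertices meeting every edge, and the matching number $\nu(\mathcal H)$ is the largest size of a set of pairwise disjoint edges; $\mathcal H$ is intersecting if $\nu(\mathcal H)=1$. An $r$-Ryser hypergraph is a hypergraph $\mathcal H$ that is $r$-uniform (all edges have exactly $r$ vertices) and $r$-partite (the vertex set can be partitioned into $r$ sides such that each edge contains at most one vertex from each side) and satisfies $\tau(\mathcal H)=(r-1)\,\nu(\mathcal H)$. We say that $\mathcal H$ is contained in $\mathcal H'$ if $\mathcal H$ is isomorphic to a sub-hypergraph of $\mathcal H'$, i.e. there is an injective map from the vertices of $\mathcal H$ to those of $\mathcal H'$ sending every edge of $\mathcal H$ to an edge of $\mathcal H'$. Write $\mathcal H\sim\mathcal H'$ if each of $\mathcal H,\mathcal H'$ is contained in the other. The $r$-Ryser poset is the set of $\sim$-classes of countable intersecting $r$-Ryser hypergraphs, partially ordered by containment. (In particular isomorphic hypergraphs represent the same element.) **Corollary.** For every $\delta>0$ there is an infinite set of integers $r$ for which the $r$-Ryser poset has $\Omega\big(\exp(r^{0.5-\delta})\big)$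 non-isomorphic (that is, distinct) maximal elements. In other words, for every $\delta>0$ there are a constant $c>0$ and an infinite set $R$ of non-negative integers such that, for every $r\in R$, the $r$-Ryser poset has at least $c\exp(r^{0.5-\delta})$ distinct maximal elements. -/

import Mathlib

namespace Hypergraph

variable {α β γ : Type*}

/-- A cover of `H` is a set of vertices of `H` that meets every edge. -/
def IsCover (H : Hypergraph α) (C : Set α) : Prop :=
  C ⊆ V(H) ∧ ∀ e ∈ E(H), (C ∩ e).Nonempty

/-- The cover number `τ(H)`: the smallest size of a cover. -/
noncomputable def coverNumber (H : Hypergraph α) : ℕ∞ :=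
  ⨅ (C : Set α) (_ : H.IsCover C), C.encard

/-- A matching of `H` is a set of pairwise disjoint edges of `H`. -/
def IsMatching (H : Hypergraph α) (M : Set (Set α)) : Prop :=
  M ⊆ E(H) ∧ ∀ e ∈ M, ∀ f ∈ M, e ≠ f → Disjoint e f

/-- The matching number `ν(H)`: the largest size of a matching. -/
noncomputable def matchingNumber (H : Hypergraph α) : ℕ∞ :=
  ⨆ (M : Set (Set α)) (_ : H.IsMatching M), M.encard

/-- `H` is intersecting if its matching number is one. -/
def IsIntersecting (H : Hypergraph α) : Prop :=
  H.matchingNumber = 1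

/-- `H` is `r`-uniform if every edge has exactly `r` vertices. -/
def IsUniform (H : Hypergraph α) (r : ℕ) : Prop :=
  ∀ e ∈ E(H), e.encard = r

/-- `H` is `r`-partite if its vertex set can be partitioned into `r` sides such that every edge
contains at most one vertex from each side. -/
def IsPartite (H : Hypergraph α) (r : ℕ) : Prop :=
  ∃ side : Fin r → Set α, (⋃ i, side i) = V(H) ∧
    (∀ i j, i ≠ j → Disjoint (side i) (side j)) ∧
    ∀ e ∈ E(H), ∀ i, (e ∩ side i).Subsingleton

/-- An `r`-Ryser hypergraph: an `r`-partite `r`-uniform hypergraph `H` with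
`τ(H) = (r - 1) ν(H)`. -/
def IsRyser (H : Hypergraph α) (r : ℕ) : Prop :=
  H.IsPartite r ∧ H.IsUniform r ∧ H.coverNumber = ((r - 1 : ℕ) : ℕ∞) * H.matchingNumber

/-- `H` is contained in `K`: some injection of the vertices of `H` into the vertices of `K` maps
every edge of `H` to an edge of `K`, that is, `H` is isomorphic to a sub-hypergraph of `K`. -/
def IsContainedIn (H : Hypergraph α) (K : Hypergraph β) : Prop :=
  ∃ f : α → β, Set.InjOn f V(H) ∧ Set.MapsTo f V(H) V(K) ∧ ∀ e ∈ E(H), f '' e ∈ E(K)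

theorem IsContainedIn.refl (H : Hypergraph α) : H.IsContainedIn H :=
  ⟨id, Set.injOn_id _, Set.mapsTo_id _, fun e he => by simpa using he⟩

theorem IsContainedIn.trans {H : Hypergraph α} {K : Hypergraph β} {L : Hypergraph γ}
    (h : H.IsContainedIn K) (k : K.IsContainedIn L) : H.IsContainedIn L := by
  obtain ⟨f, hf, hfm, hfe⟩ := h
  obtain ⟨g, hg, hgm, hge⟩ := k
  refine ⟨g ∘ f, hg.comp hf hfm, hgm.comp hfm, fun e he => ?_⟩
  rw [Set.image_comp]
  exact hge _ (hfe e he)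

end Hypergraph

/-- The countable (finite or countably infinite) intersecting `r`-Ryser hypergraphs. Every vertex
lies in an edge, so that a hypergraph is just a family of sets. Since only the isomorphism type
matters, the vertices are taken from `ℕ`. -/
structure RyserHypergraph (r : ℕ) where
  /-- the underlying hypergraph -/
  toHypergraph : Hypergraph ℕ
  /-- there are no isolated vertices -/
  vertexSet_eq : toHypergraph.vertexSet = ⋃₀ toHypergraph.edgeSet
  /-- it is an `r`-Ryser hypergraph -/
  isRyser : toHypergraph.IsRyser r
  /-- it is intersecting -/
  isIntersecting : toHypergraph.IsIntersecting

/-- Containment is a preorder on countable intersecting `r`-Ryser hypergraphs. -/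
instance (r : ℕ) : Preorder (RyserHypergraph r) where
  le H K := H.toHypergraph.IsContainedIn K.toHypergraph
  le_refl H := Hypergraph.IsContainedIn.refl H.toHypergraph
  le_trans _ _ _ h k := Hypergraph.IsContainedIn.trans h k

/-- The `r`-Ryser poset: countable intersecting `r`-Ryser hypergraphs modulo mutual containment,
ordered by containment. Isomorphic hypergraphs represent the same element, so hypergraphs
representing distinct elements are non-isomorphic. -/
abbrev RyserPoset (r : ℕ) : Type :=
  Antisymmetrization (RyserHypergraph r) (· ≤ ·)

/-!
The maximal elements come from affine planes of order `n = r - 1`. The dual of such a plane, whose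
vertices are the lines and whose edges are the pencils of lines through a point (a truncated
projective plane), is `r`-uniform, `r`-partite with the parallel classes as sides, and intersecting.
Its cover number is `n`, because a line contains only `n` of the `n ^ 2` points
(`IsAffinePlane.dualPlane_isRyser`).

It is a maximal element (`IsAffinePlane.isMax_ryser`). Suppose that it is contained in an
intersecting `r`-Ryser hypergraph `K`. Lines that are not parallel lie in a common edge, so the sides
of `K` have to induce the parallel classes (`IsAffinePlane.exists_color`). An edge of `K` therefore
contains at most one line from each parallel class, and since it meets every pencil, its lines cover
all points. Such a family of lines is a pencil (`IsAffinePlane.exists_pencil_subset`), by the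
argument that shows that a blocking set of `n + 1` points in a projective plane of order `n` is a
line. So `K` has no edges besides those of the dual plane.

A containment between two dual planes is a map of points preserving lines and parallelism
(`IsAffinePlane.exists_collineation`). For translation planes, the lines through the origin form a
spread of a vector space, and such a map is additive up to a translation
(`IsAffinePlane.map_add_of_collineation`), because sums are given by parallelograms. Hence among
spreads of one elementary abelian group of order `p ^ 4`, at most `p ^ 16`, the number of its
endomorphisms, yield the same poset element.

The André planes over the field with `p ^ 2` elements provide `2 ^ (p - 1)` spreads: for each set `S`
of nonzero norms `m ^ (p + 1)`, the lines `y = m * x` with norm in `S` are replaced by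
`y = m * x ^ p`. So for `r = p ^ 2 + 1` there are at least `2 ^ (p - 1) / p ^ 16` maximal elements
(`exists_finset_isMax`), and this eventually exceeds `exp (r ^ (1 / 2 - δ))`.
-/

open Filter
open scoped Hypergraph

/-! ### Affine planes -/

/-- The family `f` describes an affine plane of order `Nat.card W` with points `V`. The index type `ι`
is the set of parallel classes, the lines of the class `i` are labelled by `W`, and `f i v` is the
label of the line of class `i` through the point `v`. So the line labelled `(i, a)` consists of the
points `v` with `f i v = a`, and the fields `eq_of_eq` and `exists_eq` say that two points lie on
exactly one common line. -/
structure IsAffinePlane {ι V W : Type*} (f : ι → V → W) : Prop where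
  eq_of_eq : ∀ ⦃i j⦄, i ≠ j → ∀ ⦃v w⦄, f i v = f i w → f j v = f j w → v = w
  exists_eq : ∀ v w, ∃ i, f i v = f i w
  card_index : Nat.card ι = Nat.card W + 1
  card_points : Nat.card V = Nat.card W ^ 2
  one_lt_card : 1 < Nat.card W

namespace IsAffinePlane

variable {ι V W : Type*} {f : ι → V → W}

theorem finite_index (hf : IsAffinePlane f) : Finite ι :=
  Nat.finite_of_card_ne_zero (by rw [hf.card_index]; omega)

theorem finite_label (hf : IsAffinePlane f) : Finite W :=
  Nat.finite_of_card_ne_zero (by have := hf.one_lt_card; omega)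

theorem finite_points (hf : IsAffinePlane f) : Finite V :=
  Nat.finite_of_card_ne_zero (by
    rw [hf.card_points]; exact pow_ne_zero _ (by have := hf.one_lt_card; omega))

theorem nontrivial_index (hf : IsAffinePlane f) : Nontrivial ι := by
  have := hf.finite_index
  rw [← Finite.one_lt_card_iff_nontrivial, hf.card_index]
  have := hf.one_lt_card; omega

theorem nontrivial_label (hf : IsAffinePlane f) : Nontrivial W := by
  have := hf.finite_label
  exact Finite.one_lt_card_iff_nontrivial.1 hf.one_lt_card

/-- Lines from two different parallel classes meet. -/
theorem exists_point (hf : IsAffinePlane f) {i j : ι} (hij : i ≠ j) (a b : W) :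
    ∃ v, f i v = a ∧ f j v = b := by
  have := hf.finite_label
  have hinj : Function.Injective fun v => (f i v, f j v) := fun v w h =>
    hf.eq_of_eq hij (congrArg Prod.fst h) (congrArg Prod.snd h)
  have hbij := hinj.bijective_of_nat_card_le (by rw [Nat.card_prod, hf.card_points, sq])
  obtain ⟨v, hv⟩ := hbij.surjective (a, b)
  exact ⟨v, congrArg Prod.fst hv, congrArg Prod.snd hv⟩

theorem surjective (hf : IsAffinePlane f) (i : ι) : Function.Surjective (f i) := fun a => by
  have := hf.nontrivial_index
  obtain ⟨j, hj⟩ := exists_ne i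
  obtain ⟨v, hv, -⟩ := hf.exists_point hj.symm a a
  exact ⟨v, hv⟩

theorem nonempty_points (hf : IsAffinePlane f) : Nonempty V := by
  have := hf.nontrivial_index
  have := hf.nontrivial_label
  obtain ⟨i⟩ : Nonempty ι := inferInstance
  obtain ⟨a⟩ : Nonempty W := inferInstance
  exact ⟨(hf.surjective i a).choose⟩

theorem card_line [Fintype V] [DecidableEq W] (hf : IsAffinePlane f) (i : ι) (a : W) :
    (Finset.univ.filter fun v => f i v = a).card = Nat.card W := by
  have := hf.finite_label
  have := Fintype.ofFinite W
  have := hf.nontrivial_index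
  obtain ⟨j, hj⟩ := exists_ne i
  rw [Nat.card_eq_fintype_card, ← Finset.card_univ]
  refine Finset.card_nbij (f j) (fun _ _ => Finset.mem_univ _) ?_ ?_
  · intro v hv w hw h
    simp only [Finset.coe_filter, Finset.mem_univ, true_and, Set.mem_ofPred_eq] at hv hw
    exact hf.eq_of_eq hj h (hv.trans hw.symm)
  · intro b _
    obtain ⟨v, hv, hv'⟩ := hf.exists_point hj b a
    exact ⟨v, by simpa using hv', hv⟩

/-- A set of lines, at most one in each parallel class, that covers all points is a pencil. -/
theorem exists_pencil_subset (hf : IsAffinePlane f) (A : Set (ι × W))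
    (hA : ∀ i a b, (i, a) ∈ A → (i, b) ∈ A → a = b) (hcov : ∀ v, ∃ i, (i, f i v) ∈ A) :
    ∃ v, ∀ i, (i, f i v) ∈ A := by
  classical
  have := hf.finite_label
  have := hf.finite_points
  have := hf.finite_index
  have := Fintype.ofFinite V
  have := Fintype.ofFinite ι
  have := hf.nontrivial_label
  choose c hc using hcov
  -- Two lines of `A` lie in different classes: a single line does not cover all points.
  obtain ⟨v₁⟩ := hf.nonempty_points
  obtain ⟨b, hb⟩ := exists_ne (f (c v₁) v₁)
  obtain ⟨v₂, hv₂⟩ := hf.surjective (c v₁) b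
  have hij : c v₁ ≠ c v₂ := by
    intro h
    have h₂ := hc v₂
    rw [← h] at h₂
    exact hb (hv₂ ▸ hA _ _ _ h₂ (hc v₁))
  obtain ⟨v, hvi, hvj⟩ := hf.exists_point hij (f (c v₁) v₁) (f (c v₂) v₂)
  have hiA : (c v₁, f (c v₁) v) ∈ A := hvi ▸ hc v₁
  have hjA : (c v₂, f (c v₂) v) ∈ A := hvj ▸ hc v₂
  refine ⟨v, fun k => ?_⟩
  by_contra hk
  -- The points of the line of class `k` through `v` are covered by pairwise different lines of
  -- `A`, none of them in class `k`, and so each of the other classes covers one of these points.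
  have himg : Finset.image c (Finset.univ.filter fun w => f k w = f k v) =
      Finset.univ.erase k := by
    refine Finset.eq_of_subset_of_card_le ?_ ?_
    · intro i hi
      simp only [Finset.mem_image, Finset.mem_filter, Finset.mem_univ, true_and] at hi
      obtain ⟨w, hw, rfl⟩ := hi
      refine Finset.mem_erase.2 ⟨fun h => hk ?_, Finset.mem_univ _⟩
      have := hc w
      rwa [h, hw] at this
    · rw [Finset.card_image_of_injOn, hf.card_line, Finset.card_erase_of_mem (Finset.mem_univ _),
        Finset.card_univ, ← Nat.card_eq_fintype_card, hf.card_index, Nat.add_sub_cancel]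
      intro w hw w' hw' h
      simp only [Finset.coe_filter, Finset.mem_univ, true_and, Set.mem_ofPred_eq] at hw hw'
      have hne : c w ≠ k := fun h' => hk (by have := hc w; rwa [h', hw] at this)
      have h' := hc w'
      rw [← h] at h'
      exact hf.eq_of_eq hne (hA _ _ _ (hc w) h') (hw.trans hw'.symm)
  -- A class other than `k` whose line in `A` passes through `v` can only cover `v` itself.
  have key : ∀ i, (i, f i v) ∈ A → c v = i := by
    intro i hi
    have hne : i ≠ k := fun h => hk (h ▸ hi)
    have hmem : i ∈ Finset.univ.erase k := Finset.mem_erase.2 ⟨hne, Finset.mem_univ _⟩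
    rw [← himg] at hmem
    simp only [Finset.mem_image, Finset.mem_filter, Finset.mem_univ, true_and] at hmem
    obtain ⟨w, hw, rfl⟩ := hmem
    rw [hf.eq_of_eq hne (hA _ _ _ (hc w) hi) hw]
  exact hij ((key _ hiA).symm.trans (key _ hjA))

end IsAffinePlane

/-! ### Intersecting and partite hypergraphs -/

namespace Hypergraph

variable {α β κ : Type*}

theorem IsIntersecting.inter_nonempty {K : Hypergraph β} (hK : K.IsIntersecting) {r : ℕ}
    (hu : K.IsUniform r) (hr : r ≠ 0) {e e' : Set β} (he : e ∈ E(K)) (he' : e' ∈ E(K)) :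
    (e ∩ e').Nonempty := by
  by_contra h
  rw [Set.not_nonempty_iff_eq_empty, ← Set.disjoint_iff_inter_eq_empty] at h
  have hne : e ≠ e' := by
    rintro rfl
    have := hu e he
    rw [disjoint_self.1 h] at this
    simp at this
    exact hr (by exact_mod_cast this.symm)
  have hm : K.IsMatching {e, e'} := by
    refine ⟨Set.insert_subset he (Set.singleton_subset_iff.2 he'), ?_⟩
    rintro a (rfl | rfl) b (rfl | rfl) hab
    · exact absurd rfl hab
    · exact h
    · exact h.symm
    · exact absurd rfl hab
  have : ({e, e'} : Set (Set β)).encard ≤ K.matchingNumber :=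
    le_iSup₂ (f := fun M (_ : K.IsMatching M) => M.encard) _ hm
  rw [Set.encard_pair hne, hK] at this
  exact absurd this (by norm_num)

theorem isIntersecting_of_forall_inter_nonempty {K : Hypergraph β} (hne : E(K).Nonempty)
    (h : ∀ e ∈ E(K), ∀ e' ∈ E(K), (e ∩ e').Nonempty) : K.IsIntersecting := by
  refine le_antisymm (iSup₂_le fun M hM => ?_) ?_
  · refine Set.encard_le_one_iff.2 fun e e' he he' => ?_
    by_contra hee
    exact (h e (hM.1 he) e' (hM.1 he')).ne_empty
      (Set.disjoint_iff_inter_eq_empty.1 (hM.2 e he e' he' hee))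
  · obtain ⟨e, he⟩ := hne
    have hm : K.IsMatching {e} := by
      refine ⟨Set.singleton_subset_iff.2 he, ?_⟩
      rintro a rfl b rfl hab
      exact absurd rfl hab
    have := le_iSup₂ (f := fun M (_ : K.IsMatching M) => M.encard) _ hm
    rwa [Set.encard_singleton] at this

/-- The sides of a partite hypergraph as a colouring that is injective on every edge. -/
theorem IsPartite.exists_injOn {K : Hypergraph β} {r : ℕ} (hK : K.IsPartite r) (hr : r ≠ 0) :
    ∃ s : β → Fin r, ∀ e ∈ E(K), Set.InjOn s e := by
  obtain ⟨side, hV, -, hsub⟩ := hK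
  have h : ∀ x, ∃ i, x ∈ V(K) → x ∈ side i := by
    intro x
    by_cases hx : x ∈ V(K)
    · rw [← hV] at hx
      obtain ⟨i, hi⟩ := Set.mem_iUnion.1 hx
      exact ⟨i, fun _ => hi⟩
    · exact ⟨⟨0, Nat.pos_of_ne_zero hr⟩, fun h => absurd h hx⟩
  choose s hs using h
  refine ⟨s, fun e he x hx y hy hxy => hsub e he (s x) ⟨hx, hs x ?_⟩ ⟨hy, hxy ▸ hs y ?_⟩⟩
  · exact K.mem_vertexSet_of_mem_edgeSet he hx
  · exact K.mem_vertexSet_of_mem_edgeSet he hy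

end Hypergraph

/-! ### Hypergraphs containing the dual of an affine plane -/

namespace IsAffinePlane

open Hypergraph

variable {ι V W α β κ : Type*} {f : ι → V → W}

/-- Any colouring, with as many colours as there are parallel classes, of a hypergraph containing
the dual of an affine plane is constant on each parallel class. -/
theorem exists_color (hf : IsAffinePlane f) {K : Hypergraph β} {s : β → κ}
    (hs : ∀ e ∈ E(K), Set.InjOn s e) (hκ : Nat.card κ = Nat.card ι) {φ : ι × W → β}
    (hφ : Function.Injective φ) (hφE : ∀ v, (Set.range fun i => φ (i, f i v)) ∈ E(K)) :
    ∃ σ : ι → κ, Function.Injective σ ∧ ∀ i a, s (φ (i, a)) = σ i := by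
  have := hf.finite_index
  have : Finite κ := Nat.finite_of_card_ne_zero (by rw [hκ, hf.card_index]; omega)
  have := hf.nontrivial_label
  obtain ⟨a₀⟩ : Nonempty W := inferInstance
  have hne : ∀ i j a b, i ≠ j → s (φ (i, a)) ≠ s (φ (j, b)) := by
    intro i j a b hij h
    obtain ⟨v, rfl, rfl⟩ := hf.exists_point hij a b
    exact hij (congrArg Prod.fst (hφ (hs _ (hφE v) ⟨i, rfl⟩ ⟨j, rfl⟩ h)))
  refine ⟨fun i => s (φ (i, a₀)), fun i j h => by_contra fun hij => hne i j a₀ a₀ hij h,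
    fun i a => ?_⟩
  obtain ⟨v, rfl⟩ := hf.surjective i a
  have hinj : Function.Injective fun j => s (φ (j, f j v)) := fun j k h =>
    by_contra fun hjk => hne j k _ _ hjk h
  obtain ⟨j, hj⟩ := (hinj.bijective_of_nat_card_le hκ.le).surjective (s (φ (i, a₀)))
  obtain rfl : j = i := by_contra fun hji => hne j i _ _ hji hj
  exact hj

/-- The dual of an affine plane is edge-maximal: an intersecting partite uniform hypergraph
containing it has no further edges. -/
theorem eq_pencil_of_mem_edgeSet (hf : IsAffinePlane f) {K : Hypergraph β}
    (hP : K.IsPartite (Nat.card ι)) (hU : K.IsUniform (Nat.card ι)) (hI : K.IsIntersecting)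
    {φ : ι × W → β} (hφ : Function.Injective φ)
    (hφE : ∀ v, (Set.range fun i => φ (i, f i v)) ∈ E(K)) {e : Set β} (he : e ∈ E(K)) :
    ∃ v, e = Set.range fun i => φ (i, f i v) := by
  have hr : Nat.card ι ≠ 0 := by rw [hf.card_index]; omega
  obtain ⟨s, hs⟩ := hP.exists_injOn hr
  obtain ⟨σ, -, hσ⟩ := hf.exists_color hs (by simp) hφ hφE
  obtain ⟨v, hv⟩ := hf.exists_pencil_subset (φ ⁻¹' e) (fun i a b ha hb =>
      congrArg Prod.snd (hφ (hs e he ha hb ((hσ i a).trans (hσ i b).symm)))) (fun v => by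
    obtain ⟨x, hx, i, rfl⟩ := hI.inter_nonempty hU hr he (hφE v)
    exact ⟨i, hx⟩)
  have hsub : (Set.range fun i => φ (i, f i v)) ⊆ e := Set.range_subset_iff.2 hv
  have hfin : e.Finite := Set.finite_of_encard_eq_coe (hU e he)
  exact ⟨v, ((hfin.subset hsub).eq_of_subset_of_encard_le hsub ((hU e he).trans (hU _ (hφE v)).symm).le).symm⟩

end IsAffinePlane

/-! ### The dual of an affine plane is a maximal Ryser hypergraph -/

/-- The dual of the affine plane with coordinates `f`, also known as a truncated projective plane:
its vertices are the lines `(i, a)` of the plane, labelled by elements of `α` by means of `g`, and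
its edges are the pencils of lines through the points. -/
def dualPlane {ι V W α : Type*} (g : ι × W → α) (f : ι → V → W) : Hypergraph α where
  vertexSet := Set.range g
  edgeSet := Set.range fun v => Set.range fun i => g (i, f i v)
  subset_vertexSet_of_mem_edgeSet' := by
    rintro _ ⟨v, rfl⟩ _ ⟨i, rfl⟩
    exact ⟨_, rfl⟩

namespace IsAffinePlane

open Hypergraph

variable {ι V W α β κ : Type*} {f : ι → V → W} {g : ι × W → α}

theorem dualPlane_vertexSet_eq (hf : IsAffinePlane f) :
    V(dualPlane g f) = ⋃₀ E(dualPlane g f) := by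
  refine Set.Subset.antisymm ?_ sUnion_edgeSet_subset_vertexSet
  rintro _ ⟨⟨i, a⟩, rfl⟩
  obtain ⟨v, rfl⟩ := hf.surjective i a
  exact ⟨_, ⟨v, rfl⟩, i, rfl⟩

theorem dualPlane_isUniform (hg : Function.Injective g) (hf : IsAffinePlane f) :
    (dualPlane g f).IsUniform (Nat.card ι) := by
  have := hf.finite_index
  rintro _ ⟨v, rfl⟩
  have hinj : Function.Injective fun i => g (i, f i v) := fun i j h =>
    congrArg Prod.fst (hg h)
  beta_reduce
  rw [← Set.image_univ, hinj.encard_image, Set.encard_univ, ENat.card_eq_coe_natCard]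

theorem dualPlane_isPartite (hg : Function.Injective g) (hf : IsAffinePlane f) :
    (dualPlane g f).IsPartite (Nat.card ι) := by
  have := hf.finite_index
  let k := Finite.equivFin ι
  refine ⟨fun j => g '' {p | k p.1 = j}, ?_, ?_, ?_⟩
  · refine Set.Subset.antisymm (Set.iUnion_subset fun j => Set.image_subset_range _ _) ?_
    rintro _ ⟨p, rfl⟩
    exact Set.mem_iUnion.2 ⟨k p.1, p, rfl, rfl⟩
  · intro i j hij
    rw [Set.disjoint_image_iff hg, Set.disjoint_left]
    exact fun p hp hp' => hij (hp.symm.trans hp')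
  · rintro _ ⟨v, rfl⟩ j _ ⟨⟨i, rfl⟩, p, hp, hpi⟩ _ ⟨⟨i', rfl⟩, p', hp', hpi'⟩
    have h1 := hg hpi
    have h2 := hg hpi'
    subst h1 h2
    have : i = i' := k.injective (hp.trans hp'.symm)
    subst this
    rfl

theorem dualPlane_isIntersecting (hf : IsAffinePlane f) : (dualPlane g f).IsIntersecting := by
  obtain ⟨v₀⟩ := hf.nonempty_points
  refine isIntersecting_of_forall_inter_nonempty ⟨_, v₀, rfl⟩ ?_
  rintro _ ⟨v, rfl⟩ _ ⟨w, rfl⟩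
  obtain ⟨i, hi⟩ := hf.exists_eq v w
  exact ⟨g (i, f i v), ⟨i, rfl⟩, i, by simp [hi]⟩

/-- A parallel class is a cover. Conversely each line covers only `n` of the `n ^ 2` points. -/
theorem dualPlane_coverNumber (hg : Function.Injective g) (hf : IsAffinePlane f) :
    (dualPlane g f).coverNumber = Nat.card W := by
  classical
  have := hf.finite_label
  have := hf.nontrivial_index
  obtain ⟨i₀⟩ : Nonempty ι := inferInstance
  refine le_antisymm ?_ (le_iInf₂ fun C hC => ?_)
  · have hcov : (dualPlane g f).IsCover (Set.range fun a => g (i₀, a)) := by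
      refine ⟨Set.range_subset_iff.2 fun a => ⟨_, rfl⟩, ?_⟩
      rintro _ ⟨v, rfl⟩
      exact ⟨g (i₀, f i₀ v), ⟨_, rfl⟩, i₀, rfl⟩
    refine (iInf₂_le _ hcov).trans ?_
    have hinj : Function.Injective fun a => g (i₀, a) := fun a b h =>
      congrArg Prod.snd (hg h)
    rw [← Set.image_univ, hinj.encard_image, Set.encard_univ, ENat.card_eq_coe_natCard]
  · by_cases hfin : C.Finite
    · lift C to Finset α using hfin
      have := hf.finite_points
      have := Fintype.ofFinite V
      rw [Set.encard_coe_eq_coe_finsetCard, Nat.cast_le]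
      have hv : ∀ v, ∃ x ∈ C, ∃ i, g (i, f i v) = x := fun v => by
        obtain ⟨x, hx, i, hi⟩ := hC.2 _ ⟨v, rfl⟩
        exact ⟨x, hx, i, hi⟩
      choose h hhC hh using hv
      have hle := Finset.card_le_mul_card_image_of_maps_to (s := (Finset.univ : Finset V)) (t := C)
        (f := h) (fun v _ => hhC v) (Nat.card W) (fun x hx => by
          obtain ⟨⟨i, a⟩, rfl⟩ := hC.1 hx
          rw [← hf.card_line i a]
          refine Finset.card_le_card fun v hv => ?_
          simp only [Finset.mem_filter, Finset.mem_univ, true_and] at hv ⊢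
          obtain ⟨j, hj⟩ := hh v
          have := hg (hj.trans hv)
          obtain ⟨rfl, h2⟩ := Prod.mk.inj this
          exact h2)
      rw [Finset.card_univ, ← Nat.card_eq_fintype_card, hf.card_points, sq] at hle
      exact Nat.le_of_mul_le_mul_left hle (by have := hf.one_lt_card; omega)
    · rw [Set.encard_eq_top_iff.2 hfin]
      exact le_top

theorem dualPlane_isRyser (hg : Function.Injective g) (hf : IsAffinePlane f) :
    (dualPlane g f).IsRyser (Nat.card ι) := by
  refine ⟨dualPlane_isPartite hg hf, dualPlane_isUniform hg hf, ?_⟩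
  have : (dualPlane g f).matchingNumber = 1 := hf.dualPlane_isIntersecting
  rw [dualPlane_coverNumber hg hf, this, hf.card_index, Nat.add_sub_cancel, mul_one]

theorem pencil_mem_of_map {K : Hypergraph β} {φ : α → β}
    (hφ : ∀ e ∈ E(dualPlane g f), φ '' e ∈ E(K)) (v : V) :
    (Set.range fun i => (φ ∘ g) (i, f i v)) ∈ E(K) := by
  have := hφ _ ⟨v, rfl⟩
  rwa [← Set.range_comp] at this

/-- The dual of an affine plane as an element of the preorder of Ryser hypergraphs. -/
def ryser {g : ι × W → ℕ} (hg : Function.Injective g) (hf : IsAffinePlane f) :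
    RyserHypergraph (Nat.card ι) where
  toHypergraph := dualPlane g f
  vertexSet_eq := hf.dualPlane_vertexSet_eq
  isRyser := dualPlane_isRyser hg hf
  isIntersecting := hf.dualPlane_isIntersecting

theorem isMax_ryser {g : ι × W → ℕ} (hg : Function.Injective g) (hf : IsAffinePlane f) :
    IsMax (ryser hg hf) := by
  rintro K ⟨φ, hφ, -, hφE⟩
  have hinj : Function.Injective (φ ∘ g) := fun p q h => hg (hφ ⟨p, rfl⟩ ⟨q, rfl⟩ h)
  have hE := pencil_mem_of_map hφE
  have hK : ∀ e ∈ E(K.toHypergraph), ∃ v, e = Set.range fun i => (φ ∘ g) (i, f i v) :=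
    fun e he => hf.eq_pencil_of_mem_edgeSet K.isRyser.1 K.isRyser.2.1 K.isIntersecting hinj hE he
  have := hf.nontrivial_index
  have := hf.nontrivial_label
  -- Every vertex of `K` is a line of the plane, so that `φ ∘ g` has an inverse on the vertices.
  have hV : V(K.toHypergraph) ⊆ Set.range (φ ∘ g) := by
    rw [K.vertexSet_eq]
    rintro x ⟨e, he, hx⟩
    obtain ⟨v, rfl⟩ := hK e he
    obtain ⟨i, rfl⟩ := hx
    exact ⟨_, rfl⟩
  refine ⟨g ∘ Function.invFun (φ ∘ g), ?_, fun x _ => ⟨_, rfl⟩, fun e he => ?_⟩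
  · intro x hx y hy h
    rw [← Function.invFun_eq (hV hx), ← Function.invFun_eq (hV hy), hg h]
  · obtain ⟨v, rfl⟩ := hK e he
    refine ⟨v, ?_⟩
    rw [← Set.range_comp]
    exact congrArg Set.range (funext fun i =>
      congrArg g (Function.leftInverse_invFun hinj (i, f i v)).symm)

/-- A containment between duals of affine planes with equally many parallel classes comes from
a map between the points that preserves lines and parallelism. -/
theorem exists_collineation {ι' V' W' : Type*} {f' : ι' → V' → W'} {g' : ι' × W' → β}
    (hg : Function.Injective g) (hf : IsAffinePlane f) (hg' : Function.Injective g')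
    (hf' : IsAffinePlane f') (hcard : Nat.card ι' = Nat.card ι)
    (h : (dualPlane g f).IsContainedIn (dualPlane g' f')) :
    ∃ (θ : V → V') (σ : ι → ι'), Function.Injective θ ∧ Function.Injective σ ∧
      ∀ i v w, f i v = f i w → f' (σ i) (θ v) = f' (σ i) (θ w) := by
  obtain ⟨φ, hφ, -, hφE⟩ := h
  have hinj : Function.Injective (φ ∘ g) := fun p q h => hg (hφ ⟨p, rfl⟩ ⟨q, rfl⟩ h)
  have hE := pencil_mem_of_map hφE
  have := hf'.nontrivial_index
  have := hf'.nontrivial_label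
  let s : β → ι' := fun x => (Function.invFun g' x).1
  have hsg : ∀ p, s (g' p) = p.1 := fun p =>
    congrArg Prod.fst (Function.leftInverse_invFun hg' p)
  have hs : ∀ e ∈ E(dualPlane g' f'), Set.InjOn s e := by
    rintro _ ⟨v, rfl⟩ _ ⟨i, rfl⟩ _ ⟨j, rfl⟩ hij
    simp only [hsg] at hij
    simp only [hij]
  obtain ⟨σ, hσ, hσs⟩ := hf.exists_color hs hcard hinj hE
  choose θ hθ using hE
  have key : ∀ i v, (φ ∘ g) (i, f i v) = g' (σ i, f' (σ i) (θ v)) := by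
    intro i v
    obtain ⟨j, hj⟩ : (φ ∘ g) (i, f i v) ∈ Set.range fun j => g' (j, f' j (θ v)) := by
      have := hθ v
      simp only at this
      rw [this]
      exact ⟨i, rfl⟩
    have : j = σ i := by rw [← hσs i (f i v), ← hj, hsg]
    rw [← hj, this]
  refine ⟨θ, σ, fun v w hvw => ?_, hσ, fun i v w hvw => ?_⟩
  · have := hf.nontrivial_index
    have hall : ∀ i, f i v = f i w := fun i =>
      congrArg Prod.snd (hinj ((key i v).trans (by rw [hvw, key i w])))
    obtain ⟨i, j, hij⟩ := exists_pair_ne ι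
    exact hf.eq_of_eq hij (hall i) (hall j)
  · have := key i v
    rw [hvw, key i w] at this
    exact (congrArg Prod.snd (hg' this)).symm

end IsAffinePlane

/-! ### Containment between duals of translation planes -/

namespace IsAffinePlane

section Translation

variable {ι V W ι' V' W' : Type*} [AddCommGroup V] [AddCommGroup W] [AddCommGroup V']
  [AddCommGroup W'] {f : ι → V →+ W} {f' f'' : ι' → V' →+ W'}

/-- The kernels of the maps `f i` form a spread: they cover `V` and meet pairwise in zero. -/
theorem of_addMonoidHom (hinj : ∀ ⦃i j⦄, i ≠ j → ∀ ⦃v⦄, f i v = 0 → f j v = 0 → v = 0)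
    (hex : ∀ v, v ≠ 0 → ∃ i, f i v = 0) (hι : Nat.card ι = Nat.card W + 1)
    (hV : Nat.card V = Nat.card W ^ 2) (hW : 1 < Nat.card W) :
    IsAffinePlane fun i => ⇑(f i) where
  eq_of_eq i j hij v w hi hj := by
    refine sub_eq_zero.1 (hinj hij ?_ ?_)
    · rw [map_sub, hi, sub_self]
    · rw [map_sub, hj, sub_self]
  exists_eq v w := by
    by_cases h : v = w
    · have : Nonempty ι := (Nat.card_pos_iff.1 (by rw [hι]; omega)).1
      exact ⟨Classical.arbitrary ι, by rw [h]⟩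
    · obtain ⟨i, hi⟩ := hex (v - w) (sub_ne_zero.2 h)
      exact ⟨i, by rwa [map_sub, sub_eq_zero] at hi⟩
  card_index := hι
  card_points := hV
  one_lt_card := hW

/-- A collineation between translation planes that fixes the origin is additive: the sum of two
vectors on different lines through the origin is the fourth vertex of a parallelogram. -/
theorem map_add_of_collineation (hf : IsAffinePlane fun i => ⇑(f i))
    (hf' : IsAffinePlane fun i => ⇑(f' i)) {θ : V → V'} {σ : ι → ι'} (h0 : θ 0 = 0)
    (hσ : Function.Injective σ) (h : ∀ i v w, f i v = f i w → f' (σ i) (θ v) = f' (σ i) (θ w))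
    (u v : V) : θ (u + v) = θ u + θ v := by
  have hker : ∀ i v, f i v = 0 → f' (σ i) (θ v) = 0 := fun i v hv => by
    rw [h i v 0 (by rw [hv, map_zero]), h0, map_zero]
  have hindep : ∀ i j, i ≠ j → ∀ u v, f i u = 0 → f j v = 0 → θ (u + v) = θ u + θ v := by
    intro i j hij u v hu hv
    refine hf'.eq_of_eq (hσ.ne hij) ?_ ?_
    · rw [map_add, hker i u hu, zero_add]
      exact h i _ _ (by rw [map_add, hu, zero_add])
    · rw [map_add, hker j v hv, add_zero]
      exact h j _ _ (by rw [map_add, hv, add_zero])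
  have hex : ∀ v, ∃ i, f i v = 0 := fun v => by
    obtain ⟨i, hi⟩ := hf.exists_eq v 0
    exact ⟨i, by simpa using hi⟩
  obtain ⟨i, hi⟩ := hex u
  by_cases hv : f i v = 0
  · -- Both vectors lie on the same line: bring in a vector `w` off this line.
    have := hf.nontrivial_label
    obtain ⟨a, ha⟩ := exists_ne (0 : W)
    obtain ⟨w, hw⟩ := hf.surjective i a
    have hw0 : f i w ≠ 0 := fun h => ha (hw.symm.trans h)
    obtain ⟨j, hj⟩ := hex w
    obtain ⟨k, hk⟩ := hex (v + w)
    have hij : i ≠ j := fun h => hw0 (h ▸ hj)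
    have hik : i ≠ k := by
      rintro rfl
      rw [map_add, hv, zero_add] at hk
      exact hw0 hk
    have h₁ := hindep i k hik u (v + w) hi hk
    rw [← add_assoc, hindep i j hij v w hv hj,
      hindep i j hij (u + v) w (by rw [map_add, hi, hv, add_zero]) hj, ← add_assoc] at h₁
    exact add_right_cancel h₁
  · obtain ⟨j, hj⟩ := hex v
    exact hindep i j (fun h => hv (h ▸ hj)) u v hi hj

theorem exists_addMonoidHom {α β : Type*} {g : ι × W → α} {g' : ι' × W' → β}
    (hg : Function.Injective g) (hf : IsAffinePlane fun i => ⇑(f i))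
    (hg' : Function.Injective g') (hf' : IsAffinePlane fun i => ⇑(f' i))
    (hcard : Nat.card ι' = Nat.card ι)
    (h : (dualPlane g fun i => ⇑(f i)).IsContainedIn (dualPlane g' fun i => ⇑(f' i))) :
    ∃ (θ : V →+ V') (σ : ι → ι'), Function.Injective θ ∧ Function.Injective σ ∧
      ∀ i v, f i v = 0 → f' (σ i) (θ v) = 0 := by
  obtain ⟨θ, σ, hθ, hσ, hθσ⟩ := exists_collineation hg hf hg' hf' hcard h
  have hadd := map_add_of_collineation (θ := fun v => θ v - θ 0) hf hf' (sub_self _) hσ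
    fun i v w hvw => by rw [map_sub, map_sub, hθσ i v w hvw]
  refine ⟨AddMonoidHom.mk' (fun v => θ v - θ 0) hadd, σ, fun v w hvw => hθ ?_, hσ,
    fun i v hv => ?_⟩
  · exact sub_left_injective hvw
  · rw [AddMonoidHom.mk'_apply, map_sub, hθσ i v 0 (by rw [hv, map_zero]), sub_self]

/-- If an additive bijection carries one spread both into the spread of `f'` and into that of `f''`,
then each line through the origin of the plane `f'` is one of the plane `f''`. -/
theorem exists_ker_subset (hf : IsAffinePlane fun i => ⇑(f i))
    (hf' : IsAffinePlane fun i => ⇑(f' i)) {θ : V →+ V'} (hθ : Function.Surjective θ)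
    {σ τ : ι → ι'} (hσ : Function.Injective σ) (h : ∀ i v, f i v = 0 → f' (σ i) (θ v) = 0)
    (h' : ∀ i v, f i v = 0 → f'' (τ i) (θ v) = 0) (j : ι') :
    ∃ k, ∀ v, f' j v = 0 → f'' k v = 0 := by
  -- Each nonzero vector of `ker (f' j)` comes from the one kernel `ker (f i)` with `σ i = j`.
  have hex : ∀ v, v ≠ 0 → f' j v = 0 → ∃ i u, f i u = 0 ∧ θ u = v ∧ σ i = j := by
    intro v hv hjv
    obtain ⟨u, rfl⟩ := hθ v
    obtain ⟨i, hi⟩ := hf.exists_eq u 0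
    rw [map_zero] at hi
    refine ⟨i, u, hi, rfl, by_contra fun hij => hv (hf'.eq_of_eq hij ?_ ?_)⟩
    · rw [h i u hi, map_zero]
    · rw [hjv, map_zero]
  by_cases hv : ∃ v, v ≠ 0 ∧ f' j v = 0
  · obtain ⟨v, hv, hjv⟩ := hv
    obtain ⟨i, -, -, -, hi⟩ := hex v hv hjv
    refine ⟨τ i, fun w hw => ?_⟩
    by_cases hw0 : w = 0
    · rw [hw0, map_zero]
    · obtain ⟨i', u, hu, rfl, hi'⟩ := hex w hw0 hw
      rw [hσ (hi.trans hi'.symm)]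
      exact h' i' u hu
  · push Not at hv
    refine ⟨j, fun w hw => ?_⟩
    rw [by_contra fun hw0 => hv w hw0 hw, map_zero]

end Translation

end IsAffinePlane

/-! ### André planes of order `p ^ 2` -/

section Andre

variable {F : Type*} [Field F] {p : ℕ} [Fact p.Prime]

/-- The norm `x ^ (p + 1)` to the prime field is invariant under the Frobenius automorphism. -/
theorem norm_pow_prime (hF : Nat.card F = p ^ 2) (x : F) : (x ^ p) ^ (p + 1) = x ^ (p + 1) := by
  have : Finite F := Nat.finite_of_card_ne_zero (by
    rw [hF]; exact pow_ne_zero _ (Fact.out : p.Prime).ne_zero)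
  have := Fintype.ofFinite F
  have h : x ^ p ^ 2 = x := by rw [← hF, Nat.card_eq_fintype_card, FiniteField.pow_card]
  rw [← pow_mul, mul_add_one, ← sq, pow_add, h, pow_succ, mul_comm]

/-- There are `p - 1` nonzero norms: they are the powers `g ^ (k * (p + 1))` for a generator `g` of
the group of units, which has order `(p - 1) * (p + 1)`. -/
theorem exists_norms (hF : Nat.card F = p ^ 2) : ∃ T : Finset F, T.card = p - 1 ∧
    ∀ s ∈ T, ∃ m : F, m ≠ 0 ∧ m ^ (p + 1) = s := by
  classical
  have hp := (Fact.out : p.Prime)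
  have : Finite F := Nat.finite_of_card_ne_zero (by rw [hF]; exact pow_ne_zero _ hp.ne_zero)
  obtain ⟨g, hg⟩ := IsCyclic.exists_ofOrder_eq_natCard (α := Fˣ)
  have hord : orderOf g = (p - 1) * (p + 1) := by
    rw [hg, Nat.card_units, hF, mul_comm, ← Nat.sq_sub_sq, one_pow]
  refine ⟨(Finset.range (p - 1)).image fun k => ((g ^ k : Fˣ) : F) ^ (p + 1), ?_, ?_⟩
  · rw [Finset.card_image_of_injOn, Finset.card_range]
    intro k hk l hl h
    have hk' : k < p - 1 := by simpa using hk
    have hl' : l < p - 1 := by simpa using hl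
    have h' : g ^ (k * (p + 1)) = g ^ (l * (p + 1)) := by
      ext
      simpa [pow_mul] using h
    have := pow_injOn_Iio_orderOf (x := g)
      (by rw [hord]; exact Nat.mul_lt_mul_of_pos_right hk' p.succ_pos)
      (by rw [hord]; exact Nat.mul_lt_mul_of_pos_right hl' p.succ_pos) h'
    exact Nat.eq_of_mul_eq_mul_right p.succ_pos this
  · intro s hs
    obtain ⟨k, -, rfl⟩ := Finset.mem_image.1 hs
    exact ⟨_, Units.ne_zero _, rfl⟩

theorem exists_pow_prime_ne (hF : Nat.card F = p ^ 2) : ∃ x : F, x ^ p ≠ x := by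
  have hp := (Fact.out : p.Prime)
  have : Finite F := Nat.finite_of_card_ne_zero (by rw [hF]; exact pow_ne_zero _ hp.ne_zero)
  obtain ⟨g, hg⟩ := IsCyclic.exists_ofOrder_eq_natCard (α := Fˣ)
  refine ⟨g, fun h => ?_⟩
  have h' : g ^ (p - 1) = 1 := by
    have : g ^ (p - 1) * g = 1 * g := by
      rw [← pow_succ, Nat.sub_add_cancel hp.one_le, one_mul]
      ext
      simpa using h
    exact mul_right_cancel this
  have hle := Nat.le_of_dvd (by have := hp.two_le; omega) (orderOf_dvd_of_pow_eq_one h')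
  rw [hg, Nat.card_units, hF] at hle
  have := hp.two_le
  have : p < p ^ 2 := by nlinarith
  omega

variable [CharP F p]

variable (p) in
open Classical in
/-- The multiplication `m ∘ x` of an André quasifield of order `p ^ 2`: it is `m * x ^ p` if the
norm `m ^ (p + 1)` lies in `S`, and `m * x` otherwise. -/
noncomputable def andreMul (S : Finset F) (m : F) : F →+ F :=
  if m ^ (p + 1) ∈ S then (AddMonoidHom.mulLeft m).comp (frobenius F p).toAddMonoidHom
  else AddMonoidHom.mulLeft m

variable (p) in
/-- The coordinates of the André plane: the lines are `x = a` and `y - m ∘ x = a`. -/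
noncomputable def andreCoord (S : Finset F) : Option F → F × F →+ F
  | none => AddMonoidHom.fst F F
  | some m => AddMonoidHom.snd F F - (andreMul p S m).comp (AddMonoidHom.fst F F)

variable {S : Finset F}

theorem andreMul_of_mem {m : F} (hm : m ^ (p + 1) ∈ S) (x : F) :
    andreMul p S m x = m * x ^ p := by
  simp [andreMul, hm, frobenius_def]

theorem andreMul_of_notMem {m : F} (hm : m ^ (p + 1) ∉ S) (x : F) :
    andreMul p S m x = m * x := by
  simp [andreMul, hm]

theorem andreMul_one (m : F) : andreMul p S m 1 = m := by
  by_cases hm : m ^ (p + 1) ∈ S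
  · rw [andreMul_of_mem hm, one_pow, mul_one]
  · rw [andreMul_of_notMem hm, mul_one]

@[simp]
theorem andreCoord_none (v : F × F) : andreCoord p S none v = v.1 := rfl

@[simp]
theorem andreCoord_some (m : F) (v : F × F) :
    andreCoord p S (some m) v = v.2 - andreMul p S m v.1 := rfl

/-- Both multiplications by `m` multiply norms, so that the norm of the slope `m` of the line
joining the origin to `(x, m ∘ x)` does not depend on `S`. -/
theorem norm_andreMul (hF : Nat.card F = p ^ 2) (m x : F) :
    andreMul p S m x ^ (p + 1) = m ^ (p + 1) * x ^ (p + 1) := by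
  by_cases hm : m ^ (p + 1) ∈ S
  · rw [andreMul_of_mem hm, mul_pow, norm_pow_prime hF]
  · rw [andreMul_of_notMem hm, mul_pow]

theorem andreMul_left_injective (hF : Nat.card F = p ^ 2) {m m' x : F} (hx : x ≠ 0)
    (h : andreMul p S m x = andreMul p S m' x) : m = m' := by
  have hN : m ^ (p + 1) = m' ^ (p + 1) := by
    have := congrArg (· ^ (p + 1)) h
    simp only [norm_andreMul hF] at this
    exact mul_right_cancel₀ (pow_ne_zero _ hx) this
  by_cases hm : m ^ (p + 1) ∈ S
  · rw [andreMul_of_mem hm, andreMul_of_mem (hN ▸ hm)] at h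
    exact mul_right_cancel₀ (pow_ne_zero _ hx) h
  · rw [andreMul_of_notMem hm, andreMul_of_notMem (hN ▸ hm)] at h
    exact mul_right_cancel₀ hx h

theorem exists_andreMul_eq (hF : Nat.card F = p ^ 2) {x : F} (hx : x ≠ 0) (y : F) :
    ∃ m, andreMul p S m x = y := by
  by_cases hm : (y / x) ^ (p + 1) ∈ S
  · refine ⟨y / x ^ p, ?_⟩
    rw [andreMul_of_mem (by rwa [div_pow, norm_pow_prime hF, ← div_pow]),
      div_mul_cancel₀ _ (pow_ne_zero _ hx)]
  · exact ⟨y / x, by rw [andreMul_of_notMem hm, div_mul_cancel₀ _ hx]⟩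

theorem isAffinePlane_andreCoord (hF : Nat.card F = p ^ 2) (S : Finset F) :
    IsAffinePlane fun i => ⇑(andreCoord p S i) := by
  have hp := (Fact.out : p.Prime)
  have : Finite F := Nat.finite_of_card_ne_zero (by rw [hF]; exact pow_ne_zero _ hp.ne_zero)
  have hnone : ∀ m v, andreCoord p S none v = 0 → andreCoord p S (some m) v = 0 → v = 0 := by
    rintro m ⟨x, y⟩ (rfl : x = 0) h
    rw [andreCoord_some, map_zero, sub_zero] at h
    exact Prod.ext rfl h
  refine IsAffinePlane.of_addMonoidHom ?_ ?_ Finite.card_option (by rw [Nat.card_prod, sq])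
    (by rw [hF]; exact Nat.one_lt_pow two_ne_zero hp.one_lt)
  · rintro (_ | m) (_ | m') hij v hi hj
    · exact absurd rfl hij
    · exact hnone m' v hi hj
    · exact hnone m v hj hi
    · by_contra hv
      have hx : v.1 ≠ 0 := fun hx => hv (hnone m v hx hi)
      rw [andreCoord_some, sub_eq_zero] at hi hj
      exact hij (congrArg some (andreMul_left_injective hF hx (hi.symm.trans hj)))
  · rintro ⟨x, y⟩ -
    by_cases hx : x = 0
    · exact ⟨none, hx⟩
    · obtain ⟨m, hm⟩ := exists_andreMul_eq (S := S) hF hx y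
      exact ⟨some m, by rw [andreCoord_some, hm, sub_self]⟩

/-- The spread of an André plane determines the set `S` of norms of nonzero elements: only the
lines `y = m * x ^ p` with `m ^ (p + 1) ∈ S` are not of the form `x = 0` or `y = m * x`. -/
theorem subset_of_ker_subset {S' : Finset F} (hS : ∀ s ∈ S, ∃ m : F, m ≠ 0 ∧ m ^ (p + 1) = s)
    (hx : ∃ x : F, x ^ p ≠ x)
    (h : ∀ j, ∃ k, ∀ v, andreCoord p S j v = 0 → andreCoord p S' k v = 0) : S ⊆ S' := by
  intro s hs
  obtain ⟨m, hm0, rfl⟩ := hS s hs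
  by_contra hs'
  obtain ⟨x, hx⟩ := hx
  obtain ⟨k, hk⟩ := h (some m)
  have h1 := hk (1, m) (by rw [andreCoord_some, andreMul_one, sub_self])
  have hxm := hk (x, m * x ^ p) (by rw [andreCoord_some, andreMul_of_mem hs, sub_self])
  rcases k with _ | m'
  · exact one_ne_zero h1
  · rw [andreCoord_some, andreMul_one, sub_eq_zero] at h1
    obtain rfl : m = m' := h1
    rw [andreCoord_some, andreMul_of_notMem hs', sub_eq_zero] at hxm
    exact hx (mul_left_cancel₀ hm0 hxm)

theorem card_addMonoidHom_galoisField : Nat.card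
    (GaloisField p 2 × GaloisField p 2 →+ GaloisField p 2 × GaloisField p 2) = p ^ 16 := by
  rw [Nat.card_congr (AddMonoidHom.toZModLinearMapEquiv p).toEquiv,
    Module.natCard_eq_pow_finrank (K := ZMod p), Module.finrank_linearMap, Module.finrank_prod,
    GaloisField.finrank p two_ne_zero, Nat.card_zmod]

variable (p) in
/-- The map from sets of norms to the classes of the dual André planes has fibres of size at most
`p ^ 16`, since the members of a fibre are determined by additive collineations from one of them. -/
theorem exists_finset_isMax : ∃ M : Finset (RyserPoset (p ^ 2 + 1)), (∀ x ∈ M, IsMax x) ∧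
    2 ^ (p - 1) ≤ p ^ 16 * M.card := by
  classical
  let F := GaloisField p 2
  have hF : Nat.card F = p ^ 2 := GaloisField.card p 2 two_ne_zero
  have hι : Nat.card (Option F) = p ^ 2 + 1 := by rw [Finite.card_option, hF]
  have hA := fun S : Finset F => isAffinePlane_andreCoord hF S
  obtain ⟨g, hg⟩ := exists_injective_nat (Option F × F)
  obtain ⟨T, hT, hTm⟩ := exists_norms hF
  have hx := exists_pow_prime_ne hF
  have hcard := card_addMonoidHom_galoisField (p := p)
  have : Finite (F × F →+ F × F) := Nat.finite_of_card_ne_zero (by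
    rw [hcard]; exact pow_ne_zero _ (Fact.out : p.Prime).ne_zero)
  have := Fintype.ofFinite (F × F →+ F × F)
  rw [← hι]
  let Φ : Finset F → RyserPoset (Nat.card (Option F)) := fun S =>
    toAntisymmetrization (· ≤ ·) ((hA S).ryser hg)
  refine ⟨T.powerset.image Φ, fun x hx => ?_, ?_⟩
  · obtain ⟨S, -, rfl⟩ := Finset.mem_image.1 hx
    intro y
    induction y using Antisymmetrization.ind with
    | _ K => exact fun h => (hA S).isMax_ryser hg h
  · rw [← hT, ← Finset.card_powerset, ← hcard]
    refine Finset.card_le_mul_card_image _ _ fun x hx' => ?_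
    obtain ⟨S₀, -, rfl⟩ := Finset.mem_image.1 hx'
    have hθ : ∀ S, Φ S = Φ S₀ → ∃ (θ : F × F →+ F × F) (σ : Option F → Option F),
        Function.Injective θ ∧ Function.Injective σ ∧
        ∀ i v, andreCoord p S₀ i v = 0 → andreCoord p S (σ i) (θ v) = 0 := by
      intro S hS
      refine IsAffinePlane.exists_addMonoidHom hg (hA S₀) hg (hA S) rfl ?_
      exact (Quotient.exact hS).2
    choose! θ σ hθ hσ hθσ using hθ
    refine (Finset.card_le_card_of_injOn (t := Finset.univ) θ
      (fun _ _ => Finset.mem_coe.2 (Finset.mem_univ _)) ?_).trans_eq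
      (Finset.card_univ.trans Nat.card_eq_fintype_card.symm)
    have hfin : Finite (F × F) := (hA S₀).finite_points
    have hsub : ∀ S S', S ⊆ T → Φ S = Φ S₀ → Φ S' = Φ S₀ → θ S = θ S' → S ⊆ S' := by
      intro S S' hS hΦ hΦ' h
      refine subset_of_ker_subset (fun s hs => hTm s (hS hs)) hx
        (IsAffinePlane.exists_ker_subset (hA S₀) (hA S)
          (Finite.surjective_of_injective (hθ S hΦ)) (hσ S hΦ) (hθσ S hΦ) (τ := σ S') ?_)
      rw [h]
      exact hθσ S' hΦ'
    intro S hS S' hS' h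
    simp only [Finset.coe_filter, Finset.mem_powerset, Set.mem_ofPred_eq] at hS hS'
    exact Finset.Subset.antisymm (hsub S S' hS.1 hS.2 hS'.2 h)
      (hsub S' S hS'.1 hS'.2 hS.2 h.symm)

end Andre

/-! ### Counting -/

/-- `2 ^ (n - 1) / n ^ 16` eventually exceeds the exponential of any power of `n ^ 2 + 1` with
exponent less than `1 / 2`. -/
theorem eventually_exp_mul_le_two_pow {δ : ℝ} (hδ : 0 < δ) :
    ∀ᶠ n : ℕ in atTop,
      (n : ℝ) ^ 16 * Real.exp (((n ^ 2 + 1 : ℕ) : ℝ) ^ ((1 / 2 : ℝ) - δ)) ≤ 2 ^ (n - 1) := by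
  have hlog : ∀ᶠ n : ℕ in atTop, Real.log n ≤ 1 / 64 * n := by
    have := (Real.isLittleO_log_id_atTop.comp_tendsto tendsto_natCast_atTop_atTop).bound
      (show (0 : ℝ) < 1 / 64 by norm_num)
    filter_upwards [this] with n hn
    simpa using (le_abs_self _).trans hn
  have hpow : ∀ᶠ n : ℕ in atTop,
      ((n ^ 2 + 1 : ℕ) : ℝ) ^ ((1 / 2 : ℝ) - δ) ≤ 1 / 16 * ((n ^ 2 + 1 : ℕ) : ℝ) ^ (1 / 2 : ℝ) := by
    have h := (tendsto_rpow_neg_atTop hδ).eventually_le_const (show (0 : ℝ) < 1 / 16 by norm_num)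
    have ht : Tendsto (fun n : ℕ => ((n ^ 2 + 1 : ℕ) : ℝ)) atTop atTop :=
      tendsto_natCast_atTop_atTop.comp
        (tendsto_atTop_mono (fun n => (Nat.le_self_pow two_ne_zero n).trans (Nat.le_succ _))
          tendsto_id)
    filter_upwards [ht.eventually h] with n hn
    rw [sub_eq_add_neg, Real.rpow_add (by positivity), mul_comm]
    gcongr
  filter_upwards [hlog, hpow, eventually_ge_atTop 16] with n hn hn' h16
  have hnpos : (0 : ℝ) < n := by exact_mod_cast (by omega : 0 < n)
  have h16' : (16 : ℝ) ≤ n := by exact_mod_cast h16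
  have hsqrt : ((n ^ 2 + 1 : ℕ) : ℝ) ^ (1 / 2 : ℝ) ≤ 2 * n := by
    rw [← Real.sqrt_eq_rpow]
    refine Real.sqrt_le_iff.2 ⟨by positivity, ?_⟩
    push_cast
    nlinarith
  have h2 : (2 : ℝ) ^ (n - 1) = Real.exp ((n - 1) * Real.log 2) := by
    rw [mul_comm, Real.exp_mul, Real.exp_log two_pos, ← Real.rpow_natCast,
      Nat.cast_sub (by omega), Nat.cast_one]
  have hn16 : (n : ℝ) ^ 16 = Real.exp (16 * Real.log n) := by
    rw [mul_comm, Real.exp_mul, Real.exp_log hnpos]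
    norm_cast
  rw [h2, hn16, ← Real.exp_add, Real.exp_le_exp]
  have := Real.log_two_gt_d9
  nlinarith

theorem corollary4 (δ : ℝ) (hδ : 0 < δ) :
    ∃ c : ℝ, 0 < c ∧ ∃ R : Set ℕ, R.Infinite ∧ ∀ r ∈ R,
      ∃ M : Finset (RyserPoset r), (∀ x ∈ M, IsMax x) ∧
        c * Real.exp ((r : ℝ) ^ ((1 / 2 : ℝ) - δ)) ≤ (M.card : ℝ) := by
  obtain ⟨N, hN⟩ := eventually_atTop.1 (eventually_exp_mul_le_two_pow hδ)
  refine ⟨1, one_pos, (fun p => p ^ 2 + 1) '' {p | p.Prime ∧ N ≤ p}, ?_, ?_⟩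
  · refine Set.Infinite.image ?_ ?_
    · intro p _ q _ h
      exact Nat.pow_left_injective two_ne_zero (Nat.succ_injective h)
    · refine Set.infinite_of_not_bddAbove fun ⟨B, hB⟩ => ?_
      obtain ⟨p, hp, hpp⟩ := Nat.exists_infinite_primes (max N (B + 1))
      have := hB ⟨hpp, (le_max_left _ _).trans hp⟩
      have := (le_max_right N (B + 1)).trans hp
      omega
  · rintro _ ⟨p, ⟨hp, hNp⟩, rfl⟩
    have : Fact p.Prime := ⟨hp⟩
    obtain ⟨M, hM, hcard⟩ := exists_finset_isMax p
    refine ⟨M, hM, ?_⟩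
    have hp0 : (0 : ℝ) < (p : ℝ) ^ 16 := pow_pos (by exact_mod_cast hp.pos) _
    have hcard' : (2 : ℝ) ^ (p - 1) ≤ (p : ℝ) ^ 16 * M.card := by exact_mod_cast hcard
    rw [one_mul]
    exact le_of_mul_le_mul_left ((hN p hNp).trans hcard') hp0
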